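/- Let $n\ge 2$ and $m\ge 1$ be integers. Equip $(\mathbb{C}^n)^{\otimes m}$ with its standard Hermitian inner product, determined by $\langle v_1\otimes\cdots\otimes v_m,\,w_1\otimes\cdots\otimes w_m\rangle=\prod_{j}\langle v_j,w_j\rangle$, and let $\|T\|=\sqrt{\langle T,T\rangle}$. The spectral norm $\|T\|_\sigma$ of $T\in(\mathbb{C}^n)^{\otimes m}$ is the maximum of $|\langle T,u\rangle|$ over all pure tensors $u=v_1\otimes\cdots\otimes v_m$ with $\|u\|=1$. Let $\mathrm{S}_1^m(\mathbb{C}^n)$ be the set of all $T\in(\mathbb{C}^n)^{\otimes m}$ with $\|T\|=1$ that are symmetric, i.e. invariant under all permutations of the $m$ tensor factors, and put $d_{n,m}=\binom{m+n-1}{m}$. Then the minimum $$C_s=\min\{\|T\|_\sigma : T\in \mathrm{S}_1^m(\mathbb{C}^n)\}$$ exists, and for every real $\varepsilon$ with $0<\varepsilon<1$, $$C_s^2\le m^2\varepsilon^2+\frac{(n-1)\ln(4/\varepsilon)}{d_{n,m}-1}.$$ -/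

import Mathlib

/-- The space `(ℂⁿ)^{⊗m}`, in coordinates with respect to the standard basis
`e_{i₁} ⊗ ⋯ ⊗ e_{iₘ}`, with the Hermitian inner product for which this basis is orthonormal. -/
abbrev CTensor (n m : ℕ) : Type := EuclideanSpace ℂ (Fin m → Fin n)

/-- The pure tensor `v₁ ⊗ ⋯ ⊗ vₘ`. -/
noncomputable def pureTensor {n m : ℕ} (v : Fin m → EuclideanSpace ℂ (Fin n)) :
    CTensor n m :=
  WithLp.toLp 2 fun i => ∏ j, v j (i j)

/-- `⟨v₁ ⊗ ⋯ ⊗ vₘ, w₁ ⊗ ⋯ ⊗ wₘ⟩ = ∏ⱼ ⟨vⱼ, wⱼ⟩`. -/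
theorem inner_pureTensor {n m : ℕ} (v w : Fin m → EuclideanSpace ℂ (Fin n)) :
    inner ℂ (pureTensor v) (pureTensor w) = ∏ j, inner ℂ (v j) (w j) := by
  simp only [pureTensor, PiLp.inner_apply, RCLike.inner_apply, map_prod,
    ← Finset.prod_mul_distrib]
  exact (Fintype.prod_sum fun j k => (w j).ofLp k * (starRingEnd ℂ) ((v j).ofLp k)).symm

/-- The standard basis vectors of `CTensor n m` are the tensors `e_{i₁} ⊗ ⋯ ⊗ e_{iₘ}`. -/
theorem pureTensor_single {n m : ℕ} (i : Fin m → Fin n) :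
    pureTensor (fun j => EuclideanSpace.single (i j) (1 : ℂ)) = EuclideanSpace.single i 1 := by
  ext k
  by_cases h : k = i
  · subst h; simp [pureTensor]
  · obtain ⟨j, hj⟩ := Function.ne_iff.mp h
    simp only [pureTensor, PiLp.single_apply, h, if_false]
    exact Finset.prod_eq_zero (Finset.mem_univ j) (by simp [hj])

theorem norm_pureTensor {n m : ℕ} (v : Fin m → EuclideanSpace ℂ (Fin n)) :
    ‖pureTensor v‖ = ∏ j, ‖v j‖ := by
  have h := inner_pureTensor v v
  simp only [inner_self_eq_norm_sq_to_K] at h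
  rw [Finset.prod_pow] at h
  have h' : ‖pureTensor v‖ ^ 2 = (∏ j, ‖v j‖) ^ 2 := by exact_mod_cast h
  exact (pow_left_inj₀ (norm_nonneg _) (Finset.prod_nonneg fun _ _ => norm_nonneg _)
    two_ne_zero).mp h'

/-- The values `|⟨T, u⟩|`, where `u` ranges over the pure tensors with `‖u‖ = 1`. -/
def pureOverlaps {n m : ℕ} (T : CTensor n m) : Set ℝ :=
  {r | ∃ u : CTensor n m, (∃ v, u = pureTensor v) ∧ ‖u‖ = 1 ∧ r = ‖inner ℂ T u‖}

/-- The spectral norm `‖T‖_σ` of a tensor: the maximum of `|⟨T, u⟩|` over all pure tensors `u`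
with `‖u‖ = 1`. -/
noncomputable def tensorSpectralNorm {n m : ℕ} (T : CTensor n m) : ℝ :=
  sSup (pureOverlaps T)

/-- The supremum in the definition of the spectral norm is a maximum. -/
theorem isGreatest_tensorSpectralNorm {n m : ℕ} (hn : 1 ≤ n) (T : CTensor n m) :
    IsGreatest (pureOverlaps T) (tensorSpectralNorm T) := by
  let K : Set (Fin m → EuclideanSpace ℂ (Fin n)) := Set.univ.pi fun _ => Metric.sphere 0 1
  have hK : IsCompact K := isCompact_univ_pi fun _ => isCompact_sphere _ _
  have hc : Continuous fun v : Fin m → EuclideanSpace ℂ (Fin n) => ‖inner ℂ T (pureTensor v)‖ := by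
    unfold pureTensor
    fun_prop
  have himg : pureOverlaps T = (fun v => ‖inner ℂ T (pureTensor v)‖) '' K := by
    ext r
    constructor
    · rintro ⟨u, ⟨v, rfl⟩, hu, rfl⟩
      rw [norm_pureTensor] at hu
      have h0 : ∀ j, ‖v j‖ ≠ 0 := fun j hj => by
        rw [Finset.prod_eq_zero (Finset.mem_univ j) hj] at hu
        exact zero_ne_one hu
      refine ⟨fun j => ((‖v j‖⁻¹ : ℝ) : ℂ) • v j, fun j _ => ?_, ?_⟩
      · simp [norm_smul, h0 j]
      · have : pureTensor (fun j => ((‖v j‖⁻¹ : ℝ) : ℂ) • v j) = pureTensor v := by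
          ext i
          simp only [pureTensor, PiLp.smul_apply, smul_eq_mul, Finset.prod_mul_distrib,
            ← Complex.ofReal_prod, Finset.prod_inv_distrib, hu]
          simp
        simp only [this]
    · rintro ⟨v, hv, rfl⟩
      refine ⟨pureTensor v, ⟨v, rfl⟩, ?_, rfl⟩
      rw [norm_pureTensor]
      exact Finset.prod_eq_one fun j _ => by simpa using hv j (Set.mem_univ j)
  have hne : K.Nonempty :=
    ⟨fun _ => EuclideanSpace.single ⟨0, hn⟩ 1, fun j _ => by simp⟩
  rw [tensorSpectralNorm, himg]
  exact (hK.image hc).isGreatest_sSup (hne.image _)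

/-- The action of a permutation `σ` on `(ℂⁿ)^{⊗m}` by permuting the tensor factors. -/
noncomputable def permuteFactors {n m : ℕ} (σ : Equiv.Perm (Fin m)) (T : CTensor n m) :
    CTensor n m :=
  WithLp.toLp 2 fun i => T (i ∘ σ)

theorem permuteFactors_pureTensor {n m : ℕ} (σ : Equiv.Perm (Fin m))
    (v : Fin m → EuclideanSpace ℂ (Fin n)) :
    permuteFactors σ (pureTensor v) = pureTensor (v ∘ σ.symm) := by
  ext i
  simp only [permuteFactors, pureTensor, Function.comp_apply]
  exact Fintype.prod_equiv σ _ _ fun j => by simp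

/-- The set `S₁^m(ℂⁿ)` of symmetric tensors of norm `1`. -/
def unitSymmetricTensors (n m : ℕ) : Set (CTensor n m) :=
  {T | (∀ σ : Equiv.Perm (Fin m), permuteFactors σ T = T) ∧ ‖T‖ = 1}

/-- `C_s`, the least spectral norm of a symmetric tensor of norm `1`. -/
noncomputable def minSymmetricSpectralNorm (n m : ℕ) : ℝ :=
  sInf (tensorSpectralNorm '' unitSymmetricTensors n m)

/-! The bound comes from a moment method. Give a symmetric tensor coordinates of equal modulus
`1/√d` in the orthonormal basis of symmetric tensors indexed by multisets, with independent random
phases. For a unit vector `u`, expand `⟨T, u^{⊗m}⟩^K` and group its terms by the multiset of all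
`Km` indices: by Cauchy–Schwarz, `|⟨T, u^{⊗m}⟩|^{2K}` is at most a quantity independent of `u`, with
mean at most `K! · C(n+Km-1, Km) / d^K`. So some `T` satisfies this bound for every `u` at once,
with no net on the sphere (`exists_unitSymmetricTensor_moment_le`). By Banach's theorem
(`exists_norm_inner_power_eq`), powers `u^{⊗m}` suffice to compute the spectral norm.

Taking `K = (n-1)k` and extracting roots gives `C_s² ≤ ((n-1)/d) (k!(mk+1))^{1/k}`. A suitable `k`
bounds the last factor by `L = 1/2 + (5/2) log 2 + (3/2) log m` (`exists_moment_bound`). With `a =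
(n-1)/(d-1)`, the minimum over `ε` of `m²ε² + a log(4/ε)` is at least `aL`, because `am ≤ 1`
(`mul_log_le_of_pos`). -/

/-! ### Factorials and binomial coefficients -/

/-- Raising `k` by one adds `r` factors, each at most `r(k+2)`. The `r!` is kept because it cancels
the denominator of the binomial bound in `factorial_mul_choose_le`. -/
theorem factorial_mul_succ_le (r k : ℕ) :
    (r * (k + 1)).factorial ≤ r.factorial * r ^ (r * k) * (k + 1).factorial ^ r := by
  induction k with
  | zero => simp
  | succ k ih =>
    calc (r * (k + 1 + 1)).factorial
        = (r * (k + 1)).factorial * (r * (k + 1) + 1).ascFactorial r := by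
          rw [Nat.factorial_mul_ascFactorial]; ring_nf
      _ ≤ (r.factorial * r ^ (r * k) * (k + 1).factorial ^ r) * (r * (k + 1) + r) ^ r :=
          Nat.mul_le_mul ih (Nat.ascFactorial_le_pow_add _ _)
      _ = r.factorial * r ^ (r * (k + 1)) * (k + 1 + 1).factorial ^ r := by
          rw [Nat.factorial_succ (k + 1), show r * (k + 1) + r = r * (k + 1 + 1) by ring,
            mul_pow, mul_pow, mul_add, pow_add, mul_one]
          ring

theorem factorial_mul_choose_le (r k m : ℕ) (hk : 1 ≤ k) :
    ((r * k).factorial : ℝ) * ((r * k * m + r).choose r : ℝ) ≤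
      (r : ℝ) ^ (r * k) * ((k.factorial : ℝ) * (m * k + 1)) ^ r := by
  obtain ⟨k, rfl⟩ := Nat.exists_eq_add_of_le' hk
  have h1 : ((r * (k + 1)).factorial : ℝ) ≤
      r.factorial * r ^ (r * k) * (k + 1).factorial ^ r := by
    exact_mod_cast factorial_mul_succ_le r k
  have h2 : ((r * (k + 1) * m + r).choose r : ℝ) ≤
      ((r * (k + 1) * m + r : ℕ) : ℝ) ^ r / r.factorial := Nat.choose_le_pow_div r _
  have hf : (0 : ℝ) < r.factorial := by exact_mod_cast r.factorial_pos
  calc _ ≤ (r.factorial * r ^ (r * k) * (k + 1).factorial ^ r : ℝ) *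
        (((r * (k + 1) * m + r : ℕ) : ℝ) ^ r / r.factorial) := by gcongr
    _ = _ := by
      have : ((r * (k + 1) * m + r : ℕ) : ℝ) = r * (m * ((k + 1 : ℕ) : ℝ) + 1) := by
        push_cast; ring
      rw [this, mul_pow, mul_pow, mul_add, pow_add, mul_one]
      field_simp

theorem one_add_mul_le_choose (r m : ℕ) : 1 + r * m ≤ (m + r).choose m := by
  induction r with
  | zero => simp
  | succ r ih =>
    rcases m with _ | m
    · simp
    have h : (m + 1 + (r + 1)).choose (m + 1) =
        (m + 1 + r).choose m + (m + 1 + r).choose (m + 1) := Nat.choose_succ_succ _ _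
    have h' : m + 1 ≤ (m + 1 + r).choose m := by
      calc m + 1 = (m + 1).choose m := by simp
        _ ≤ _ := Nat.choose_le_choose m (by omega)
    rw [h]
    nlinarith

/-! ### Choice of the exponent `k` -/

theorem log_lower_bound {p q : ℕ} {x : ℝ} (h : (2 : ℝ) ^ p ≤ x ^ q) :
    p * Real.log 2 ≤ q * Real.log x := by
  rw [← Real.log_pow, ← Real.log_pow]
  exact Real.log_le_log (by positivity) h

theorem log_ge_log_add {x y : ℝ} (hy : 0 < y) (h : y ≤ x) :
    Real.log y + 2 * ((x - y) / (x + y)) ≤ Real.log x := by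
  have h0 : 0 ≤ (x - y) / y := div_nonneg (by linarith) hy.le
  have h1 := Real.le_log_one_add_of_nonneg h0
  have e1 : 1 + (x - y) / y = x / y := by field_simp; ring
  rw [e1, Real.log_div (by linarith) hy.ne'] at h1
  have e2 : 2 * ((x - y) / y) / ((x - y) / y + 2) = 2 * ((x - y) / (x + y)) := by
    have : (x - y) / y + 2 = (x + y) / y := by field_simp; ring
    rw [this]
    field_simp
  rw [e2] at h1
  linarith

/-- This is `k = 4`, the base of the induction below; `21.76` slightly exceeds `8e`. Bounding `log
x` from the anchors `c = 8` and `c = 12` in the variable `y = (x-c)/(x+c)` leaves a polynomial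
inequality on `0 ≤ y ≤ 0.3`. -/
theorem fourth_moment_bound {x : ℝ} (h8 : 8 ≤ x) (hx : x ≤ 21.76) :
    24 * (4 * x + 1) ≤ (1 / 2 + 5 / 2 * Real.log 2 + 3 / 2 * Real.log x) ^ 4 := by
  have l2 := Real.log_two_gt_d9
  rcases le_total x 12 with h | h
  · have h1 := log_ge_log_add (by norm_num : (0 : ℝ) < 8) h8
    have l8 : Real.log 8 = 3 * Real.log 2 := by
      rw [show (8 : ℝ) = 2 ^ 3 by norm_num, Real.log_pow]; norm_num
    set y := (x - 8) / (x + 8) with hy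
    have y0 : 0 ≤ y := div_nonneg (by linarith) (by linarith)
    have y1 : y ≤ 0.3 := by rw [hy, div_le_iff₀ (by linarith)]; linarith
    have hxy : x * (1 - y) = 8 * (1 + y) := by
      rw [hy]; have : x + 8 ≠ 0 := by linarith
      field_simp; ring
    -- `5.35` lies just below `1/2 + 7 log 2`, the value of the base at `x = 8`.
    have hb : (5.35 + 3 * y) ^ 4 ≤ (1 / 2 + 5 / 2 * Real.log 2 + 3 / 2 * Real.log x) ^ 4 := by
      apply pow_le_pow_left₀ (by linarith); linarith
    refine le_trans ?_ hb
    have hp : 24 * (4 * (8 * (1 + y)) + (1 - y)) ≤ (5.35 + 3 * y) ^ 4 * (1 - y) := by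
      have y2 : y ^ 2 ≤ 0.3 * y := by nlinarith
      have y3 : y ^ 3 ≤ 0.09 * y := by nlinarith
      have y4 : y ^ 4 ≤ 0.027 * y := by nlinarith
      have y5 : y ^ 5 ≤ 0.0081 * y := by nlinarith
      nlinarith
    rw [← hxy] at hp
    have : 0 < 1 - y := by linarith
    nlinarith
  · have h1 := log_ge_log_add (by norm_num : (0 : ℝ) < 12) h
    have l3 := log_lower_bound (p := 19) (q := 12) (x := 3) (by norm_num)
    have l12 : Real.log 12 = 2 * Real.log 2 + Real.log 3 := by
      rw [show (12 : ℝ) = 2 ^ 2 * 3 by norm_num, Real.log_mul (by norm_num) (by norm_num),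
        Real.log_pow]; norm_num
    push_cast at l3
    set y := (x - 12) / (x + 12) with hy
    have y0 : 0 ≤ y := div_nonneg (by linarith) (by linarith)
    have y1 : y ≤ 0.3 := by rw [hy, div_le_iff₀ (by linarith)]; linarith
    have hxy : x * (1 - y) = 12 * (1 + y) := by
      rw [hy]; have : x + 12 ≠ 0 := by linarith
      field_simp; ring
    -- `5.958` lies just below the value of the base at `x = 12`, with `log 3 ≥ (19/12) log 2`.
    have hb : (5.958 + 3 * y) ^ 4 ≤ (1 / 2 + 5 / 2 * Real.log 2 + 3 / 2 * Real.log x) ^ 4 := by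
      apply pow_le_pow_left₀ (by linarith); linarith
    refine le_trans ?_ hb
    have hp : 24 * (4 * (12 * (1 + y)) + (1 - y)) ≤ (5.958 + 3 * y) ^ 4 * (1 - y) := by
      have y3 : y ^ 3 ≤ 0.3 * y ^ 2 := by nlinarith
      have y4 : y ^ 4 ≤ 0.09 * y ^ 2 := by nlinarith
      have y5 : y ^ 5 ≤ 0.027 * y ^ 2 := by nlinarith
      nlinarith
    rw [← hxy] at hp
    have : 0 < 1 - y := by linarith
    nlinarith

/-- This is `pow_succ_step` at its worst `y`. It amounts to `e ≤ (3/2)(1 + 1/k)^(k-1)`, which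
follows from the binomial expansion to second order. -/
theorem exp_le_mul_pow {k : ℕ} (hk : 4 ≤ k) :
    Real.exp 1 * ((k : ℝ) + 1) ^ 2 / k ≤ 3 / 2 * k * (((k : ℝ) + 1) / k) ^ (k + 1) := by
  have hk0 : (0 : ℝ) < k := by exact_mod_cast (by omega : 0 < k)
  have hk4 : (4 : ℝ) ≤ k := by exact_mod_cast hk
  have hb : ∀ j : ℕ, ∀ x : ℝ, 0 ≤ x →
      1 + j * x + (j * (j - 1)) / 2 * x ^ 2 ≤ (1 + x) ^ j := by
    intro j x hx
    induction j with
    | zero => simp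
    | succ j ih =>
      rw [pow_succ (1 + x)]
      have h0 : (0 : ℝ) ≤ (j * (j - 1)) / 2 * x ^ 2 * x := by
        rcases j with _ | j
        · simp
        · push_cast; simp only [add_sub_cancel_right]; positivity
      have := mul_le_mul_of_nonneg_right ih (by linarith : 0 ≤ 1 + x)
      push_cast
      nlinarith
  obtain ⟨j, rfl⟩ := Nat.exists_eq_add_of_le' (by omega : 1 ≤ k)
  have h := hb j (1 / ((j + 1 : ℕ) : ℝ)) (by positivity)
  have e1 := Real.exp_one_lt_d9
  set K : ℝ := ((j + 1 : ℕ) : ℝ) with hK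
  have hj : (j : ℝ) = K - 1 := by rw [hK]; push_cast; ring
  -- The middle expression is `1.9375` at `K = 4`, and `(3/2) · 1.9 = 2.85 > e`.
  have hlow : (1.9 : ℝ) ≤ 1 + j * (1 / K) + (j * (j - 1)) / 2 * (1 / K) ^ 2 := by
    have : 1 + j * (1 / K) + (j * (j - 1)) / 2 * (1 / K) ^ 2 =
        (K ^ 2 + (K - 1) * K + (K - 1) * (K - 2) / 2) / K ^ 2 := by
      rw [hj]; field_simp; ring
    rw [this, le_div_iff₀ (by positivity)]
    nlinarith
  have hs : 1 + 1 / K = (K + 1) / K := by field_simp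
  rw [hs] at h
  have h' : (1.9 : ℝ) ≤ ((K + 1) / K) ^ j := hlow.trans h
  have : 3 / 2 * K * ((K + 1) / K) ^ (j + 1 + 1) =
      3 / 2 * ((K + 1) / K) ^ j * ((K + 1) ^ 2 / K) := by
    rw [pow_succ, pow_succ]; field_simp
  rw [this, mul_div_assoc]
  gcongr
  linarith

/-- The ratio `(y + 3/2)^(k+1) / y^k` is least at `y = 3k/2`; Bernoulli's inequality centred there
gives its minimum. -/
theorem pow_succ_step {k : ℕ} (hk : 4 ≤ k) {y : ℝ} (hy : 0 < y) :
    Real.exp 1 * ((k : ℝ) + 1) ^ 2 / k * y ^ k ≤ (y + 3 / 2) ^ (k + 1) := by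
  have hk0 : (0 : ℝ) < k := by exact_mod_cast (by omega : 0 < k)
  have hB := one_add_mul_le_pow (a := (y + 3 / 2) * k / ((k + 1) * y) - 1) (n := k + 1) (by
    have : 0 ≤ (y + 3 / 2) * k / ((k + 1) * y) := by positivity
    linarith)
  have e : 1 + ((k + 1 : ℕ) : ℝ) * ((y + 3 / 2) * k / ((k + 1) * y) - 1) = 3 / 2 * k / y := by
    push_cast; field_simp; ring
  rw [e, add_sub_cancel, div_pow, le_div_iff₀ (by positivity)] at hB
  have h := exp_le_mul_pow hk
  calc _ ≤ 3 / 2 * k * (((k : ℝ) + 1) / k) ^ (k + 1) * y ^ k := by gcongr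
    _ = (3 / 2 * k / y * ((k + 1) * y) ^ (k + 1)) / (k : ℝ) ^ (k + 1) := by
      rw [div_pow, mul_pow, pow_succ y]; field_simp
    _ ≤ ((y + 3 / 2) * k) ^ (k + 1) / (k : ℝ) ^ (k + 1) := by gcongr
    _ = _ := by rw [mul_pow]; field_simp

/-- Multiplying `x` by `e` raises the base on the right by `3/2`. Passing from `k` to `k + 1`
multiplies the left side by at most `e(k+1)²/k`, which `pow_succ_step` absorbs. -/
theorem exists_moment_bound_of_eight_le (j : ℕ) : ∀ x : ℝ, 8 ≤ x → x ≤ 8 * Real.exp 1 ^ (j + 1) →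
    ∃ k : ℕ, 4 ≤ k ∧ (k.factorial : ℝ) * (x * k + 1) ≤
      (1 / 2 + 5 / 2 * Real.log 2 + 3 / 2 * Real.log x) ^ k := by
  have e1 := Real.exp_one_lt_d9
  induction j with
  | zero =>
    intro x h8 hx
    refine ⟨4, le_rfl, ?_⟩
    rw [zero_add, pow_one] at hx
    have := fourth_moment_bound h8 (by linarith)
    norm_num [Nat.factorial] at this ⊢
    linarith
  | succ j ih =>
    intro x h8 hx
    have e0 := Real.exp_pos 1
    by_cases h : x ≤ 8 * Real.exp 1 ^ (j + 1)
    · exact ih x h8 h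
    have he1 : 1 ≤ Real.exp 1 := Real.one_le_exp (by norm_num)
    push Not at h
    have h8' : 8 ≤ x / Real.exp 1 := by
      rw [le_div_iff₀ e0]
      refine le_trans ?_ h.le
      gcongr
      exact le_self_pow₀ he1 (by omega)
    obtain ⟨k, hk, hb⟩ := ih (x / Real.exp 1) h8' (by
      rw [div_le_iff₀ e0]; rwa [pow_succ, ← mul_assoc] at hx)
    refine ⟨k + 1, by omega, ?_⟩
    have hk0 : (0 : ℝ) < k := by exact_mod_cast (by omega : 0 < k)
    rw [Real.log_div (by linarith) e0.ne', Real.log_exp] at hb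
    set z := x / Real.exp 1 with hz
    have hxz : x = z * Real.exp 1 := by rw [hz]; field_simp
    set y := 1 / 2 + 5 / 2 * Real.log 2 + 3 / 2 * (Real.log x - 1) with hy
    have hy0 : 0 < y := by
      have l2 := Real.log_two_gt_d9
      have : Real.log 8 ≤ Real.log x := Real.log_le_log (by norm_num) h8
      have l8 : Real.log 8 = 3 * Real.log 2 := by
        rw [show (8 : ℝ) = 2 ^ 3 by norm_num, Real.log_pow]; norm_num
      linarith
    have hy' : 1 / 2 + 5 / 2 * Real.log 2 + 3 / 2 * Real.log x = y + 3 / 2 := by rw [hy]; ring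
    rw [hy']
    refine le_trans ?_ (pow_succ_step hk hy0)
    calc (((k + 1).factorial : ℕ) : ℝ) * (x * ((k + 1 : ℕ) : ℝ) + 1)
        = (k + 1) * k.factorial * (z * Real.exp 1 * (k + 1) + 1) := by
          rw [Nat.factorial_succ, hxz]; push_cast; ring
      _ ≤ (k + 1) * k.factorial * (Real.exp 1 * (k + 1) / k * (z * k + 1)) := by
          gcongr
          have : Real.exp 1 * (k + 1) / k * (z * k + 1) =
            z * Real.exp 1 * (k + 1) + Real.exp 1 * ((k + 1) / k) := by field_simp
          rw [this]
          have h1 : (1 : ℝ) ≤ (k + 1) / k := by rw [le_div_iff₀ hk0]; linarith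
          nlinarith
      _ = Real.exp 1 * (k + 1) ^ 2 / k * (k.factorial * (z * k + 1)) := by field_simp
      _ ≤ _ := by gcongr

theorem exists_moment_bound (m : ℕ) (hm : 1 ≤ m) :
    ∃ k : ℕ, 1 ≤ k ∧ (k.factorial : ℝ) * (m * k + 1) ≤
      (1 / 2 + 5 / 2 * Real.log 2 + 3 / 2 * Real.log m) ^ k := by
  have l2 := Real.log_two_gt_d9
  have key : ∀ k : ℕ, ∀ a : ℝ, 0 ≤ a → (k.factorial : ℝ) * (m * k + 1) ≤ a ^ k →
      a ≤ 1 / 2 + 5 / 2 * Real.log 2 + 3 / 2 * Real.log m →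
      (k.factorial : ℝ) * (m * k + 1) ≤
      (1 / 2 + 5 / 2 * Real.log 2 + 3 / 2 * Real.log m) ^ k :=
    fun k a ha h1 h2 => h1.trans (pow_le_pow_left₀ ha h2 k)
  have l3 := log_lower_bound (p := 11) (q := 7) (x := 3) (by norm_num)
  have l5 := log_lower_bound (p := 16) (q := 7) (x := 5) (by norm_num)
  have l7 := log_lower_bound (p := 14) (q := 5) (x := 7) (by norm_num)
  have l4 : Real.log 4 = 2 * Real.log 2 := by
    rw [show (4 : ℝ) = 2 ^ 2 by norm_num, Real.log_pow]; norm_num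
  have l6 : Real.log 6 = Real.log 2 + Real.log 3 := by
    rw [show (6 : ℝ) = 2 * 3 by norm_num, Real.log_mul (by norm_num) (by norm_num)]
  push_cast at l3 l5 l7
  by_cases h8 : 8 ≤ m
  · have h8' : (8 : ℝ) ≤ m := by exact_mod_cast h8
    obtain ⟨j, hj⟩ := pow_unbounded_of_one_lt (m : ℝ)
      (Real.one_lt_exp_iff.mpr (zero_lt_one (α := ℝ)))
    obtain ⟨k, hk, h⟩ := exists_moment_bound_of_eight_le j m h8' (by
      have : Real.exp 1 ^ j ≤ Real.exp 1 ^ (j + 1) :=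
        pow_le_pow_right₀ (Real.one_le_exp (by norm_num)) (by omega)
      linarith)
    exact ⟨k, by omega, h⟩
  have : m < 8 := by omega
  -- For each `m < 8`, a `k` is given with a decimal lying between `(k!(mk+1))^(1/k)` and the
  -- target.
  interval_cases m
  · exact ⟨1, le_rfl, key 1 2.2 (by norm_num) (by norm_num) (by norm_num; linarith)⟩
  · exact ⟨1, le_rfl, key 1 3.2 (by norm_num) (by norm_num) (by norm_num; linarith)⟩
  · exact ⟨2, by norm_num, key 2 3.8 (by norm_num) (by norm_num) (by norm_num; linarith)⟩
  · exact ⟨2, by norm_num, key 2 4.3 (by norm_num) (by norm_num) (by norm_num; linarith)⟩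
  · exact ⟨3, by norm_num, key 3 4.6 (by norm_num) (by norm_num [Nat.factorial])
      (by norm_num; linarith)⟩
  · exact ⟨3, by norm_num, key 3 4.9 (by norm_num) (by norm_num [Nat.factorial])
      (by norm_num; linarith)⟩
  · exact ⟨3, by norm_num, key 3 5.1 (by norm_num) (by norm_num [Nat.factorial])
      (by norm_num; linarith)⟩

/-- The right side is least at `ε² = a/(2x²)`, so the inequality `log t ≤ t - 1` is used at `t =
2x²ε²/a`. The remaining `-(1/2) log a` is at least `(1/2) log x` since `ax ≤ 1`. -/
theorem mul_log_le_of_pos {a x ε : ℝ} (ha : 0 < a) (hx : 0 < x) (hax : a * x ≤ 1) (hε : 0 < ε) :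
    a * (1 / 2 + 5 / 2 * Real.log 2 + 3 / 2 * Real.log x) ≤
      x ^ 2 * ε ^ 2 + a * Real.log (4 / ε) := by
  have h := Real.log_le_sub_one_of_pos (show 0 < 2 * (x ^ 2 * ε ^ 2 / a) by positivity)
  have h2 : Real.log (a * x) ≤ 0 := Real.log_nonpos (by positivity) hax
  rw [Real.log_mul ha.ne' hx.ne'] at h2
  rw [Real.log_mul (by norm_num) (by positivity), Real.log_div (by positivity) ha.ne',
    Real.log_mul (by positivity) (by positivity), Real.log_pow, Real.log_pow] at h
  rw [Real.log_div (by norm_num) hε.ne', show (4 : ℝ) = 2 ^ 2 by norm_num, Real.log_pow]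
  push_cast at h ⊢
  have e : x ^ 2 * ε ^ 2 = a * (x ^ 2 * ε ^ 2 / a) := by field_simp
  rw [e, ← mul_add]
  exact mul_le_mul_of_nonneg_left (by linarith) ha.le

/-! ### Multisets of values -/

/-- The multiset of values of a finite family. -/
def valueMultiset {ι α : Type*} [Fintype ι] (g : ι → α) : Sym α (Fintype.card ι) :=
  ⟨Finset.univ.val.map g, by simp⟩

theorem valueMultiset_comp_perm {ι α : Type*} [Fintype ι] (g : ι → α) (σ : Equiv.Perm ι) :
    valueMultiset (g ∘ σ) = valueMultiset g := by
  apply Subtype.ext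
  change Finset.univ.val.map (g ∘ σ) = Finset.univ.val.map g
  rw [← Multiset.map_map, Multiset.map_univ_val_equiv]

theorem valueMultiset_surjective (ι α : Type*) [Fintype ι] :
    Function.Surjective (valueMultiset : (ι → α) → Sym α (Fintype.card ι)) := by
  rintro ⟨s, hs⟩
  obtain ⟨l, rfl⟩ := Quot.exists_rep s
  have hl : Fintype.card ι = l.length := hs.symm
  refine ⟨l.get ∘ ((Fintype.equivFin ι).trans (finCongr hl)), Subtype.ext ?_⟩
  change Finset.univ.val.map (l.get ∘ _) = (l : Multiset α)
  rw [← Multiset.map_map, Multiset.map_univ_val_equiv, Fin.univ_val_map]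
  simp

theorem exists_perm_of_card_fiber_eq {ι S : Type*} [Fintype ι] [DecidableEq S] {s s' : ι → S}
    (h : ∀ t, (Finset.univ.filter fun a => s a = t).card =
      (Finset.univ.filter fun a => s' a = t).card) : ∃ σ : Equiv.Perm ι, s' = s ∘ σ := by
  have e : ∀ t, {a // s' a = t} ≃ {a // s a = t} := fun t => by
    apply Fintype.equivOfCardEq
    rw [Fintype.card_subtype, Fintype.card_subtype]
    exact (h t).symm
  exact ⟨Equiv.ofFiberEquiv e, funext fun a => (Equiv.ofFiberEquiv_map e a).symm⟩

/-! ### Random phases as characters of a finite group -/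

section Characters

variable {ι S : Type*} [Fintype ι] {N : ℕ} [NeZero N]

/-- The character `x ↦ ∏ₐ exp(2πi x(s a) / N)` of `S → ZMod N`. -/
noncomputable def monomialChar (N : ℕ) [NeZero N] (s : ι → S) : AddChar (S → ZMod N) ℂ where
  toFun x := ∏ a, ZMod.stdAddChar (x (s a))
  map_zero_eq_one' := by simp
  map_add_eq_mul' x y := by
    simp [AddChar.map_add_eq_mul, Finset.prod_mul_distrib]

theorem monomialChar_apply (s : ι → S) (x : S → ZMod N) :
    monomialChar N s x = ∏ a, ZMod.stdAddChar (x (s a)) := rfl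

/-- Evaluating at the indicator of `t` recovers the multiplicity of `t` modulo `N`, hence exactly,
as multiplicities are below `N`. -/
theorem exists_perm_of_monomialChar_eq [DecidableEq S] {s s' : ι → S}
    (hN : Fintype.card ι < N) (h : monomialChar N s = monomialChar N s') :
    ∃ σ : Equiv.Perm ι, s' = s ∘ σ := by
  apply exists_perm_of_card_fiber_eq
  intro t
  have key : ∀ s : ι → S, monomialChar N s (Pi.single t 1) =
      ZMod.stdAddChar (((Finset.univ.filter fun a => s a = t).card : ℕ) : ZMod N) := by
    intro s
    rw [monomialChar_apply]
    have : ∀ a, ZMod.stdAddChar ((Pi.single t 1 : S → ZMod N) (s a)) =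
        if s a = t then ZMod.stdAddChar (1 : ZMod N) else 1 := fun a => by
      by_cases ha : s a = t
      · simp [ha]
      · simp [ha]
    simp only [this]
    rw [Finset.prod_ite, Finset.prod_const, Finset.prod_const_one, mul_one,
      ← AddChar.map_nsmul_eq_pow, nsmul_one]
  have h1 := congrArg (fun χ => χ (Pi.single t 1)) h
  simp only [key] at h1
  have h2 := ZMod.injective_stdAddChar h1
  rw [ZMod.natCast_eq_natCast_iff'] at h2
  have hc : ∀ s : ι → S, (Finset.univ.filter fun a => s a = t).card < N := fun s =>
    lt_of_le_of_lt (Finset.card_le_univ _) hN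
  rwa [Nat.mod_eq_of_lt (hc s), Nat.mod_eq_of_lt (hc s')] at h2

theorem sum_addChar_mul_conj {G : Type*} [AddCommGroup G] [Fintype G] (ψ φ : AddChar G ℂ)
    [Decidable (ψ = φ)] :
    ∑ x, ψ x * (starRingEnd ℂ) (φ x) = if ψ = φ then (Fintype.card G : ℂ) else 0 := by
  have h := AddChar.wInner_cWeight_eq_boole φ ψ
  rw [RCLike.wInner_cWeight_eq_expect, Fintype.expect_eq_sum_div_card] at h
  have hG : (Fintype.card G : ℂ) ≠ 0 := by exact_mod_cast Fintype.card_ne_zero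
  simp only [RCLike.inner_apply] at h
  rw [div_eq_iff hG] at h
  rw [h]
  by_cases hc : ψ = φ
  · simp [hc]
  · simp [hc, Ne.symm hc]

theorem sum_normSq_sum_addChar {G κ : Type*} [AddCommGroup G] [Fintype G]
    (s : Finset κ) (χ : κ → AddChar G ℂ) (p : κ → ℝ) [DecidableEq (AddChar G ℂ)] :
    ∑ x, ‖∑ k ∈ s, (p k : ℂ) * χ k x‖ ^ 2 =
      Fintype.card G * ∑ k ∈ s, ∑ l ∈ s, if χ k = χ l then p k * p l else 0 := by
  have h : (((∑ x, ‖∑ k ∈ s, (p k : ℂ) * χ k x‖ ^ 2 : ℝ)) : ℂ) =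
      ((Fintype.card G * ∑ k ∈ s, ∑ l ∈ s, if χ k = χ l then p k * p l else 0 : ℝ) : ℂ) := by
    push_cast
    simp only [← Complex.mul_conj', map_sum, map_mul, Complex.conj_ofReal, Finset.sum_mul_sum]
    rw [Finset.sum_comm, Finset.mul_sum]
    refine Finset.sum_congr rfl fun k _ => ?_
    rw [Finset.sum_comm, Finset.mul_sum]
    refine Finset.sum_congr rfl fun l _ => ?_
    have : ∀ x, (p k : ℂ) * χ k x * (p l * (starRingEnd ℂ) (χ l x)) =
        p k * p l * (χ k x * (starRingEnd ℂ) (χ l x)) := fun x => by ring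
    simp only [this, ← Finset.mul_sum, sum_addChar_mul_conj]
    split_ifs <;> push_cast <;> ring
  exact_mod_cast h

end Characters

/-! ### Second moments of weighted character sums -/

section SecondMoment

variable {J S : Type*} [Fintype J] [DecidableEq S]

/-- `1 / √N`, where `N` is the cardinality of the fibre of `τ` over `s`. -/
noncomputable def fiberWeight (τ : J → S) (s : S) : ℝ :=
  (Real.sqrt (Finset.univ.filter fun j => τ j = s).card)⁻¹

theorem fiberWeight_nonneg (τ : J → S) (s : S) : 0 ≤ fiberWeight τ s :=
  inv_nonneg.mpr (Real.sqrt_nonneg _)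

theorem fiberWeight_sq (τ : J → S) (s : S) :
    fiberWeight τ s ^ 2 = ((Finset.univ.filter fun j => τ j = s).card : ℝ)⁻¹ := by
  rw [fiberWeight, inv_pow, Real.sq_sqrt (Nat.cast_nonneg _)]

theorem sum_fiberWeight_sq [Fintype S] {τ : J → S} (hτ : Function.Surjective τ) :
    ∑ j, fiberWeight τ (τ j) ^ 2 = Fintype.card S := by
  rw [← Finset.sum_fiberwise Finset.univ τ]
  have : ∀ s, ∑ j with τ j = s, fiberWeight τ (τ j) ^ 2 = 1 := fun s => by
    obtain ⟨j, hj⟩ := hτ s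
    have hc : ((Finset.univ.filter fun j => τ j = s).card : ℝ) ≠ 0 := by
      exact_mod_cast (Finset.card_pos.mpr ⟨j, by simpa using hj⟩).ne'
    rw [Finset.sum_congr rfl fun j hj => by rw [(Finset.mem_filter.mp hj).2],
      Finset.sum_const, nsmul_eq_mul, fiberWeight_sq, mul_inv_cancel₀ hc]
  simp [this]

/-- Each nonzero term is the product of the reciprocal fibre sizes, and the number of such `I'` is
the product of those sizes. -/
theorem sum_fiberWeight_le {ι : Type*} [Fintype ι] [DecidableEq ι] (τ : J → S) (I : ι → J)
    (σ : Equiv.Perm ι) :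
    ∑ I' : ι → J, (if τ ∘ I' = (τ ∘ I) ∘ σ then
      (∏ a, fiberWeight τ (τ (I a))) * ∏ a, fiberWeight τ (τ (I' a)) else 0) ≤ 1 := by
  have h1 : ∀ I' : ι → J, (if τ ∘ I' = (τ ∘ I) ∘ σ then
      (∏ a, fiberWeight τ (τ (I a))) * ∏ a, fiberWeight τ (τ (I' a)) else 0) =
      if τ ∘ I' = (τ ∘ I) ∘ σ then ∏ a, fiberWeight τ (τ (I a)) ^ 2 else 0 := fun I' => by
    split_ifs with h
    · have : ∏ a, fiberWeight τ (τ (I' a)) = ∏ a, fiberWeight τ (τ (I a)) := by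
        rw [← Equiv.prod_comp σ fun a => fiberWeight τ (τ (I a))]
        exact Finset.prod_congr rfl fun a _ => congrArg _ (congrFun h a)
      rw [this, ← Finset.prod_mul_distrib]
      exact Finset.prod_congr rfl fun a _ => (sq _).symm
    · rfl
  simp only [h1]
  rw [← Finset.sum_filter, Finset.sum_const, nsmul_eq_mul]
  have h2 : (Finset.univ.filter fun I' : ι → J => τ ∘ I' = (τ ∘ I) ∘ σ) =
      Fintype.piFinset fun a => Finset.univ.filter fun j => τ j = τ (I (σ a)) := by
    ext I'
    simp [funext_iff]
  rw [h2, Fintype.card_piFinset, Equiv.prod_comp σ fun a =>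
    (Finset.univ.filter fun j => τ j = τ (I a)).card, Nat.cast_prod, ← Finset.prod_mul_distrib]
  simp only [fiberWeight_sq]
  exact Finset.prod_le_one (fun a _ => by positivity) fun a _ => mul_inv_le_one

/-- By orthogonality only pairs with the same character survive. These differ by a permutation after
applying `τ`, and each of the `K!` permutations contributes at most `1` for each `I`. -/
theorem sum_normSq_weighted_le [Fintype S] {ι : Type*} [Fintype ι] [DecidableEq ι]
    {N : ℕ} [NeZero N] (hN : Fintype.card ι < N) (τ : J → S) (s : Finset (ι → J)) :
    ∑ x : S → ZMod N,
      ‖∑ I ∈ s, ∏ a, ((fiberWeight τ (τ (I a)) : ℂ) * ZMod.stdAddChar (x (τ (I a))))‖ ^ 2 ≤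
    Fintype.card (S → ZMod N) * ((Fintype.card ι).factorial * s.card) := by
  classical
  have h := sum_normSq_sum_addChar s (fun I : ι → J => monomialChar N (τ ∘ I))
    (fun I => ∏ a, fiberWeight τ (τ (I a)))
  have e : ∀ (x : S → ZMod N) (I : ι → J),
      ∏ a, ((fiberWeight τ (τ (I a)) : ℂ) * ZMod.stdAddChar (x (τ (I a)))) =
      ((∏ a, fiberWeight τ (τ (I a)) : ℝ) : ℂ) * monomialChar N (τ ∘ I) x := fun x I => by
    rw [Finset.prod_mul_distrib, monomialChar_apply]
    push_cast
    rfl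
  simp only [e]
  rw [h]
  refine mul_le_mul_of_nonneg_left ?_ (Nat.cast_nonneg _)
  have hp : ∀ I : ι → J, 0 ≤ ∏ a, fiberWeight τ (τ (I a)) := fun I =>
    Finset.prod_nonneg fun _ _ => fiberWeight_nonneg _ _
  rw [mul_comm ((Fintype.card ι).factorial : ℝ), ← nsmul_eq_mul]
  refine Finset.sum_le_card_nsmul _ _ _ fun I _ => ?_
  calc _ ≤ ∑ I' ∈ s, ∑ σ : Equiv.Perm ι, (if τ ∘ I' = (τ ∘ I) ∘ σ then
      (∏ a, fiberWeight τ (τ (I a))) * ∏ a, fiberWeight τ (τ (I' a)) else 0) := by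
        refine Finset.sum_le_sum fun I' _ => ?_
        have h0 : ∀ σ : Equiv.Perm ι, 0 ≤ (if τ ∘ I' = (τ ∘ I) ∘ σ then
            (∏ a, fiberWeight τ (τ (I a))) * ∏ a, fiberWeight τ (τ (I' a)) else 0) := fun σ => by
          split_ifs
          · exact mul_nonneg (hp _) (hp _)
          · rfl
        split_ifs with hc
        · obtain ⟨σ, hσ⟩ := exists_perm_of_monomialChar_eq hN hc
          refine le_trans ?_ (Finset.single_le_sum (fun σ _ => h0 σ) (Finset.mem_univ σ))
          rw [if_pos hσ]
        · exact Finset.sum_nonneg fun σ _ => h0 σ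
    _ ≤ ∑ I' : ι → J, ∑ σ : Equiv.Perm ι, (if τ ∘ I' = (τ ∘ I) ∘ σ then
      (∏ a, fiberWeight τ (τ (I a))) * ∏ a, fiberWeight τ (τ (I' a)) else 0) := by
        refine Finset.sum_le_sum_of_subset_of_nonneg (Finset.subset_univ _) fun I' _ _ =>
          Finset.sum_nonneg fun σ _ => ?_
        split_ifs
        · exact mul_nonneg (hp _) (hp _)
        · rfl
    _ ≤ ∑ _σ : Equiv.Perm ι, (1 : ℝ) := by
        rw [Finset.sum_comm]
        exact Finset.sum_le_sum fun σ _ => sum_fiberWeight_le τ I σ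
    _ = _ := by simp [Fintype.card_perm]

end SecondMoment

/-! ### The random tensor and its moments -/

/-- Cauchy–Schwarz for a sum grouped along the fibres of `γ`, where `b` is constant on fibres. -/
theorem normSq_sum_mul_le {κ Γ : Type*} [Fintype κ] [Fintype Γ] [DecidableEq Γ]
    (γ : κ → Γ) (a : κ → ℂ) (b : Γ → ℂ) :
    ‖∑ k, a k * b (γ k)‖ ^ 2 ≤
      (∑ k, ‖b (γ k)‖ ^ 2) *
        ∑ g, ‖∑ k with γ k = g, a k‖ ^ 2 / (Finset.univ.filter fun k => γ k = g).card := by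
  set M : Γ → ℝ := fun g => ((Finset.univ.filter fun k => γ k = g).card : ℝ) with hM
  have hM0 : ∀ g, 0 ≤ M g := fun g => Nat.cast_nonneg _
  have h1 : ∑ k, a k * b (γ k) = ∑ g, (∑ k with γ k = g, a k) * b g := by
    rw [← Finset.sum_fiberwise Finset.univ γ]
    refine Finset.sum_congr rfl fun g _ => ?_
    rw [Finset.sum_mul]
    exact Finset.sum_congr rfl fun k hk => by rw [(Finset.mem_filter.mp hk).2]
  have h2 : ∑ k, ‖b (γ k)‖ ^ 2 = ∑ g, (Real.sqrt (M g) * ‖b g‖) ^ 2 := by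
    rw [← Finset.sum_fiberwise Finset.univ γ]
    refine Finset.sum_congr rfl fun g _ => ?_
    rw [Finset.sum_congr rfl fun k hk => by rw [(Finset.mem_filter.mp hk).2],
      Finset.sum_const, nsmul_eq_mul, mul_pow, Real.sq_sqrt (hM0 g)]
  have h3 : ∀ g, ‖∑ k with γ k = g, a k‖ ^ 2 / M g =
      (‖∑ k with γ k = g, a k‖ / Real.sqrt (M g)) ^ 2 := fun g => by
    rw [div_pow, Real.sq_sqrt (hM0 g)]
  have h4 : ∀ g, ‖(∑ k with γ k = g, a k) * b g‖ =
      (Real.sqrt (M g) * ‖b g‖) * (‖∑ k with γ k = g, a k‖ / Real.sqrt (M g)) := fun g => by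
    rw [norm_mul]
    rcases (hM0 g).eq_or_lt with h0 | h0
    · have : (Finset.univ.filter fun k => γ k = g) = ∅ := by
        have hc : ((Finset.univ.filter fun k => γ k = g).card : ℝ) = 0 := h0.symm
        exact Finset.card_eq_zero.mp (by exact_mod_cast hc)
      simp [this]
    · have := (Real.sqrt_pos.mpr h0).ne'
      field_simp
  change _ ≤ _ * ∑ g, ‖∑ k with γ k = g, a k‖ ^ 2 / M g
  rw [h1, h2]
  simp only [h3]
  refine le_trans ?_ (Finset.sum_mul_sq_le_sq_mul_sq _ _ _)
  refine pow_le_pow_left₀ (norm_nonneg _) ((norm_sum_le _ _).trans ?_) 2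
  simp only [h4]
  exact le_rfl

theorem sum_prod_normSq {n m : ℕ} (u : EuclideanSpace ℂ (Fin n)) :
    ∑ i : Fin m → Fin n, ∏ j, ‖u (i j)‖ ^ 2 = (‖u‖ ^ 2) ^ m := by
  rw [EuclideanSpace.norm_sq_eq, Fintype.sum_pow]

/-- The tensor with coordinates `conj z(τ i) / √(d N(τ i))`, where `τ i` is the multiset of entries
of `i`, `N` is the number of indices with these entries, `d` the number of multisets and `z` takes
values in the roots of unity. -/
noncomputable def phaseTensor {n m N : ℕ} [NeZero N]
    (x : Sym (Fin n) (Fintype.card (Fin m)) → ZMod N) : CTensor n m :=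
  WithLp.toLp 2 fun i => (starRingEnd ℂ)
    ((fiberWeight valueMultiset (valueMultiset i) : ℂ) * ZMod.stdAddChar (x (valueMultiset i))) /
      (Real.sqrt (Fintype.card (Sym (Fin n) (Fintype.card (Fin m)))) : ℂ)

theorem norm_stdAddChar_apply {N : ℕ} [NeZero N] (c : ZMod N) : ‖ZMod.stdAddChar c‖ = 1 :=
  AddChar.norm_apply _ _

theorem phaseTensor_mem {n m N : ℕ} [NeZero N] (hn : 1 ≤ n)
    (x : Sym (Fin n) (Fintype.card (Fin m)) → ZMod N) :
    phaseTensor x ∈ unitSymmetricTensors n m := by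
  constructor
  · intro σ
    ext i
    simp only [permuteFactors, phaseTensor, valueMultiset_comp_perm]
  · have hd : (0 : ℝ) < Fintype.card (Sym (Fin n) (Fintype.card (Fin m))) := by
      have : Nonempty (Sym (Fin n) (Fintype.card (Fin m))) :=
        ⟨valueMultiset fun _ => ⟨0, hn⟩⟩
      exact_mod_cast Fintype.card_pos
    have h : ‖phaseTensor x‖ ^ 2 = 1 := by
      rw [EuclideanSpace.norm_sq_eq]
      have : ∀ i, ‖phaseTensor x i‖ ^ 2 = fiberWeight valueMultiset (valueMultiset i) ^ 2 /
          Fintype.card (Sym (Fin n) (Fintype.card (Fin m))) := fun i => by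
        simp only [phaseTensor, norm_div, RCLike.norm_conj, norm_mul, norm_stdAddChar_apply,
          mul_one, Complex.norm_real, Real.norm_eq_abs, div_pow, sq_abs]
        rw [Real.sq_sqrt hd.le]
      simp only [this]
      rw [← Finset.sum_div, sum_fiberWeight_sq (valueMultiset_surjective _ _), div_self hd.ne']
    have := norm_nonneg (phaseTensor x)
    nlinarith

/-- The monomial in `u` attached to `I` depends only on `γ I`, the multiset of all its entries.
Grouped Cauchy–Schwarz therefore separates `u` from the phases, and a single choice of phases serves
every `u`. -/
theorem exists_unitSymmetricTensor_moment_le {n : ℕ} (hn : 1 ≤ n) (m K : ℕ) :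
    ∃ T ∈ unitSymmetricTensors n m, ∀ u : EuclideanSpace ℂ (Fin n), ‖u‖ = 1 →
      ‖inner ℂ T (pureTensor fun _ => u)‖ ^ (2 * K) ≤
        (K.factorial : ℝ) * ((n + K * m - 1).choose (K * m) : ℝ) /
          ((n + m - 1).choose m : ℝ) ^ K := by
  classical
  set S := Sym (Fin n) (Fintype.card (Fin m))
  have hSc : Fintype.card S = (n + m - 1).choose m :=
    (Sym.card_sym_eq_choose _).trans (by simp)
  let τ : (Fin m → Fin n) → S := valueMultiset
  let γ : (Fin K → Fin m → Fin n) → Sym (Fin n) (Fintype.card (Fin K × Fin m)) :=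
    fun I => valueMultiset fun p : Fin K × Fin m => I p.1 p.2
  have hΓ : Fintype.card (Sym (Fin n) (Fintype.card (Fin K × Fin m))) =
      (n + K * m - 1).choose (K * m) := by
    rw [Sym.card_sym_eq_choose]; simp
  let A : (S → ZMod (K + 1)) → Sym (Fin n) (Fintype.card (Fin K × Fin m)) → ℂ := fun x g =>
    ∑ I with γ I = g, ∏ a, ((fiberWeight τ (τ (I a)) : ℂ) * ZMod.stdAddChar (x (τ (I a))))
  let M : Sym (Fin n) (Fintype.card (Fin K × Fin m)) → ℝ := fun g =>
    ((Finset.univ.filter fun I => γ I = g).card : ℝ)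
  -- On average over `x`, each class `g` contributes at most `K!`: the second moment is at most `K!
  -- · M g`. Phases of order `K + 1` suffice, as multiplicities are at most `K`.
  have hA : ∑ x, ∑ g, ‖A x g‖ ^ 2 / M g ≤
      ∑ _x : S → ZMod (K + 1), (K.factorial : ℝ) * ((n + K * m - 1).choose (K * m) : ℝ) := by
    rw [Finset.sum_comm, Finset.sum_const, nsmul_eq_mul, ← hΓ, Finset.card_univ]
    have : ∀ g ∈ Finset.univ, ∑ x, ‖A x g‖ ^ 2 / M g ≤
        Fintype.card (S → ZMod (K + 1)) * (K.factorial : ℝ) := fun g _ => by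
      rw [← Finset.sum_div]
      have h := sum_normSq_weighted_le (N := K + 1) (ι := Fin K) (by simp) τ
        (Finset.univ.filter fun I => γ I = g)
      have hK : (Fintype.card (Fin K)).factorial = K.factorial := by simp
      rw [hK, ← mul_assoc] at h
      exact div_le_of_le_mul₀ (Nat.cast_nonneg _) (by positivity) h
    refine (Finset.sum_le_card_nsmul _ _ _ this).trans (le_of_eq ?_)
    rw [nsmul_eq_mul, Finset.card_univ]
    ring
  obtain ⟨x, -, hx⟩ := Finset.exists_le_of_sum_le Finset.univ_nonempty hA
  refine ⟨phaseTensor x, phaseTensor_mem hn x, fun u hu => ?_⟩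
  have hinner : inner ℂ (phaseTensor x) (pureTensor fun _ => u) =
      (∑ i, ((fiberWeight τ (τ i) : ℂ) * ZMod.stdAddChar (x (τ i))) * ∏ j, u (i j)) /
        (Real.sqrt (Fintype.card S) : ℂ) := by
    rw [PiLp.inner_apply, Finset.sum_div]
    refine Finset.sum_congr rfl fun i _ => ?_
    simp only [RCLike.inner_apply, phaseTensor, pureTensor, map_div₀, Complex.conj_conj,
      Complex.conj_ofReal]
    ring
  have hpow : (∑ i, ((fiberWeight τ (τ i) : ℂ) * ZMod.stdAddChar (x (τ i))) * ∏ j, u (i j)) ^ K =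
      ∑ I : Fin K → Fin m → Fin n,
        (∏ a, ((fiberWeight τ (τ (I a)) : ℂ) * ZMod.stdAddChar (x (τ (I a))))) *
          ((γ I).1.map u).prod := by
    rw [Fintype.sum_pow]
    refine Finset.sum_congr rfl fun I _ => ?_
    rw [Finset.prod_mul_distrib]
    congr 1
    simp only [γ, valueMultiset, Multiset.map_map]
    exact (Fintype.prod_prod_type fun p : Fin K × Fin m => u (I p.1 p.2)).symm
  -- The sum factors as `(‖u‖²)^(mK)`, so `u` drops out of the estimate.
  have hone : ∑ I : Fin K → Fin m → Fin n, ‖((γ I).1.map u).prod‖ ^ 2 = 1 := by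
    have : ∀ I : Fin K → Fin m → Fin n, ‖((γ I).1.map u).prod‖ ^ 2 =
        ∏ a, ∏ j, ‖u (I a j)‖ ^ 2 := fun I => by
      simp only [γ, valueMultiset, Multiset.map_map]
      change ‖∏ p : Fin K × Fin m, u (I p.1 p.2)‖ ^ 2 = _
      rw [norm_prod, ← Finset.prod_pow, Fintype.prod_prod_type]
    simp only [this]
    rw [← Fintype.sum_pow (fun i : Fin m → Fin n => ∏ j, ‖u (i j)‖ ^ 2), sum_prod_normSq, hu]
    simp
  have hCS := normSq_sum_mul_le γ
    (fun I => ∏ a, ((fiberWeight τ (τ (I a)) : ℂ) * ZMod.stdAddChar (x (τ (I a)))))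
    (fun g => (g.1.map u).prod)
  rw [← hpow, hone, one_mul, norm_pow, ← pow_mul, mul_comm K 2] at hCS
  rw [hinner, norm_div, div_pow, Complex.norm_real, Real.norm_eq_abs, pow_mul |Real.sqrt _|,
    sq_abs, Real.sq_sqrt (Nat.cast_nonneg _), hSc]
  gcongr
  exact hCS.trans hx

/-! ### Banach's theorem on symmetric tensors -/

/-- `pureTensor` as a multilinear map. -/
noncomputable def pureTensorMultilinear (n m : ℕ) :
    MultilinearMap ℂ (fun _ : Fin m => EuclideanSpace ℂ (Fin n)) (CTensor n m) where
  toFun := pureTensor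
  map_update_add' v a x y := by
    ext i
    have h : ∀ z : EuclideanSpace ℂ (Fin n), ∏ j, (Function.update v a z j) (i j) =
        z (i a) * ∏ j ∈ Finset.univ.erase a, v j (i j) := fun z => by
      rw [← Finset.mul_prod_erase _ _ (Finset.mem_univ a), Function.update_self]
      congr 1
      exact Finset.prod_congr rfl fun j hj => by
        rw [Function.update_of_ne (Finset.ne_of_mem_erase hj)]
    simp only [pureTensor, PiLp.add_apply, h]
    ring
  map_update_smul' v a c x := by
    ext i
    have h : ∀ z : EuclideanSpace ℂ (Fin n), ∏ j, (Function.update v a z j) (i j) =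
        z (i a) * ∏ j ∈ Finset.univ.erase a, v j (i j) := fun z => by
      rw [← Finset.mul_prod_erase _ _ (Finset.mem_univ a), Function.update_self]
      congr 1
      exact Finset.prod_congr rfl fun j hj => by
        rw [Function.update_of_ne (Finset.ne_of_mem_erase hj)]
    simp only [pureTensor, PiLp.smul_apply, h, smul_eq_mul]
    ring

/-- The multilinear form `v ↦ ⟨T, v₁ ⊗ ⋯ ⊗ vₘ⟩`. -/
noncomputable def overlapForm {n m : ℕ} (T : CTensor n m) :
    MultilinearMap ℂ (fun _ : Fin m => EuclideanSpace ℂ (Fin n)) ℂ :=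
  (innerSL ℂ T).toLinearMap.compMultilinearMap (pureTensorMultilinear n m)

theorem overlapForm_apply {n m : ℕ} (T : CTensor n m) (v : Fin m → EuclideanSpace ℂ (Fin n)) :
    overlapForm T v = inner ℂ T (pureTensor v) := rfl

theorem inner_permuteFactors {n m : ℕ} (σ : Equiv.Perm (Fin m)) (A B : CTensor n m) :
    inner ℂ (permuteFactors σ A) (permuteFactors σ B) = inner ℂ A B := by
  simp only [PiLp.inner_apply, permuteFactors]
  exact Equiv.sum_comp (σ.symm.arrowCongr (Equiv.refl (Fin n)))
    fun i : Fin m → Fin n => inner ℂ (A i) (B i)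

theorem overlapForm_comp_perm {n m : ℕ} {T : CTensor n m}
    (hT : ∀ σ : Equiv.Perm (Fin m), permuteFactors σ T = T) (σ : Equiv.Perm (Fin m))
    (v : Fin m → EuclideanSpace ℂ (Fin n)) : overlapForm T (v ∘ σ) = overlapForm T v := by
  rw [overlapForm_apply, overlapForm_apply, ← inner_permuteFactors σ T, hT,
    permuteFactors_pureTensor]
  congr 2
  ext j : 1
  simp

theorem norm_overlapForm_le {n m : ℕ} (hn : 1 ≤ n) (T : CTensor n m)
    {v : Fin m → EuclideanSpace ℂ (Fin n)} (hv : ∀ j, ‖v j‖ = 1) :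
    ‖overlapForm T v‖ ≤ tensorSpectralNorm T :=
  (isGreatest_tensorSpectralNorm hn T).2
    ⟨pureTensor v, ⟨v, rfl⟩, by simp [norm_pureTensor, hv], rfl⟩

theorem exists_norm_overlapForm_eq {n m : ℕ} (hn : 1 ≤ n) (T : CTensor n m) :
    ∃ v : Fin m → EuclideanSpace ℂ (Fin n), (∀ j, ‖v j‖ = 1) ∧
      ‖overlapForm T v‖ = tensorSpectralNorm T := by
  obtain ⟨u, ⟨v, rfl⟩, hu, hr⟩ := (isGreatest_tensorSpectralNorm hn T).1
  rw [norm_pureTensor] at hu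
  have h0 : ∀ j, ‖v j‖ ≠ 0 := fun j hj => by
    rw [Finset.prod_eq_zero (Finset.mem_univ j) hj] at hu
    exact zero_ne_one hu
  refine ⟨fun j => ((‖v j‖⁻¹ : ℝ) : ℂ) • v j, fun j => by simp [norm_smul, h0 j], ?_⟩
  rw [MultilinearMap.map_smul_univ, hr, overlapForm_apply, ← Complex.ofReal_prod,
    Finset.prod_inv_distrib, hu]
  simp

/-- A functional attaining its norm at a unit vector `y` is a multiple of `⟨y, ·⟩`. -/
theorem linearMap_eq_mul_inner_of_norm_attained {E : Type*} [NormedAddCommGroup E]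
    [InnerProductSpace ℂ E] [FiniteDimensional ℂ E] (φ : E →ₗ[ℂ] ℂ) {y : E} (hy : ‖y‖ = 1)
    (h : ∀ z, ‖z‖ = 1 → ‖φ z‖ ≤ ‖φ y‖) (z : E) : φ z = φ y * inner ℂ y z := by
  have : CompleteSpace E := FiniteDimensional.complete ℂ E
  set p := (InnerProductSpace.toDual ℂ E).symm φ.toContinuousLinearMap with hp
  have hφ : ∀ z, inner ℂ p z = φ z := fun z => by
    rw [hp, InnerProductSpace.toDual_symm_apply]; rfl
  by_cases hp0 : p = 0
  · rw [← hφ, ← hφ, hp0]; simp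
  have hpn : ‖p‖ ≠ 0 := norm_ne_zero_iff.mpr hp0
  -- Testing on `p/‖p‖` forces equality in Cauchy–Schwarz for `p` and `y`, so `p` is a multiple of
  -- `y`.
  have h1 := h (((‖p‖⁻¹ : ℝ) : ℂ) • p) (by simp [norm_smul, hpn])
  rw [← hφ, ← hφ, inner_smul_right, inner_self_eq_norm_sq_to_K] at h1
  have h2 : ‖((‖p‖⁻¹ : ℝ) : ℂ) * (‖p‖ : ℂ) ^ 2‖ = ‖p‖ := by
    rw [norm_mul, norm_pow, Complex.norm_real, Complex.norm_real, norm_norm, norm_inv, norm_norm]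
    field_simp
  have h3 : ‖inner ℂ p y‖ = ‖p‖ * ‖y‖ := le_antisymm (norm_inner_le_norm _ _) (by
    rw [hy, mul_one]; exact h2.symm.le.trans h1)
  have hy0 : y ≠ 0 := fun h => by simp [h] at hy
  have h4 := (norm_inner_eq_norm_iff (𝕜 := ℂ) hy0 hp0).mp (by
    rw [norm_inner_symm, h3, mul_comm])
  obtain ⟨r, -, hr⟩ := h4
  rw [← hφ, ← hφ, hr, inner_smul_left, inner_smul_left, inner_self_eq_norm_sq_to_K, hy]
  simp

/-- Replacing two arguments of a norm-maximising tuple by their normalised sum keeps the value. -/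
theorem norm_overlapForm_update_update {n m : ℕ} (hn : 1 ≤ n) {T : CTensor n m}
    (hT : ∀ σ : Equiv.Perm (Fin m), permuteFactors σ T = T)
    {v : Fin m → EuclideanSpace ℂ (Fin n)} (hv : ∀ j, ‖v j‖ = 1)
    (hmax : ‖overlapForm T v‖ = tensorSpectralNorm T) {a b : Fin m} (hab : a ≠ b) :
    ‖overlapForm T (Function.update (Function.update v a (v a + v b)) b (v a + v b))‖ =
      tensorSpectralNorm T * ‖v a + v b‖ ^ 2 := by
  set x := v a with hx
  set y := v b with hy
  set B : EuclideanSpace ℂ (Fin n) → EuclideanSpace ℂ (Fin n) → ℂ := fun z w =>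
    overlapForm T (Function.update (Function.update v a z) b w) with hB
  have hself : Function.update (Function.update v a x) b y = v := by
    rw [hx, Function.update_eq_self, hy, Function.update_eq_self]
  have hxy : B x y = overlapForm T v := by simp only [hB, hself]
  have hsymm : ∀ z w, B z w = B w z := fun z w => by
    simp only [hB]
    rw [← overlapForm_comp_perm hT (Equiv.swap a b)]
    congr 1
    ext j : 1
    by_cases ha : j = a
    · subst ha; simp [Function.update_of_ne hab]
    by_cases hb : j = b
    · subst hb; simp [Function.update_of_ne hab]
    · simp [Equiv.swap_apply_of_ne_of_ne ha hb, Function.update_of_ne ha, Function.update_of_ne hb]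
  have hle : ∀ z w, ‖z‖ = 1 → ‖w‖ = 1 → ‖B z w‖ ≤ ‖B x y‖ := fun z w hz hw => by
    rw [hxy, hmax]
    refine norm_overlapForm_le hn T fun j => ?_
    by_cases hb : j = b
    · subst hb; simpa
    by_cases ha : j = a
    · subst ha; simpa [Function.update_of_ne hb]
    · simpa [Function.update_of_ne ha, Function.update_of_ne hb] using hv j
  have hlin : ∀ z, ∃ φ : EuclideanSpace ℂ (Fin n) →ₗ[ℂ] ℂ, ∀ w, φ w = B z w := fun z =>
    ⟨(overlapForm T).toLinearMap (Function.update v a z) b, fun w => rfl⟩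
  have hadd : ∀ z w w', B z (w + w') = B z w + B z w' := fun z w w' => by
    obtain ⟨φ, hφ⟩ := hlin z
    rw [← hφ, ← hφ, ← hφ, map_add]
  have h1 : ∀ z, B x z = B x y * inner ℂ y z := by
    obtain ⟨φ, hφ⟩ := hlin x
    have := linearMap_eq_mul_inner_of_norm_attained φ (hv b)
      (fun z hz => by rw [hφ, hφ]; exact hle x z (hv a) hz)
    intro z
    rw [← hφ, ← hφ]; exact this z
  have h2 : ∀ z, B y z = B x y * inner ℂ x z := by
    obtain ⟨φ, hφ⟩ := hlin y
    have := linearMap_eq_mul_inner_of_norm_attained φ (hv a)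
      (fun z hz => by rw [hφ, hφ, hsymm y (v a)]; exact hle y z (hv b) hz)
    intro z
    rw [hsymm x y, ← hφ, ← hφ]; exact this z
  -- By `h1` and `h2`, the four terms are `B x y` times `⟨y,x⟩`, `1`, `1` and `⟨x,y⟩`, whose sum is
  -- `‖x + y‖²`.
  have h3 : B (x + y) (x + y) = B x y * ((‖x + y‖ : ℂ) ^ 2) := by
    rw [hadd, hsymm (x + y) x, hsymm (x + y) y, hadd, hadd, h1 x, h2 x, h2 y]
    have hsum := inner_self_eq_norm_sq_to_K (𝕜 := ℂ) (x + y)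
    have hxx : inner ℂ x x = (1 : ℂ) := by rw [inner_self_eq_norm_sq_to_K, hv a]; simp
    have hyy : inner ℂ y y = (1 : ℂ) := by rw [inner_self_eq_norm_sq_to_K, hv b]; simp
    rw [inner_add_left, inner_add_right, inner_add_right, hxx, hyy] at hsum
    rw [hxx]
    refine Eq.trans ?_ (congrArg _ hsum)
    ring
  change ‖B (x + y) (x + y)‖ = _
  rw [h3, norm_mul, hxy, hmax, norm_pow, Complex.norm_real, norm_norm]

/-- Banach's theorem: the spectral norm of a symmetric tensor is attained at a tensor power. -/
theorem exists_norm_inner_power_eq {n m : ℕ} (hn : 1 ≤ n) (hm : 1 ≤ m) {T : CTensor n m}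
    (hT : ∀ σ : Equiv.Perm (Fin m), permuteFactors σ T = T) :
    ∃ u : EuclideanSpace ℂ (Fin n), ‖u‖ = 1 ∧
      ‖inner ℂ T (pureTensor fun _ => u)‖ = tensorSpectralNorm T := by
  obtain ⟨v₀, hv₀, hv₀max⟩ := exists_norm_overlapForm_eq hn T
  set e := v₀ ⟨0, hm⟩ with he
  let P : Set (Fin m → EuclideanSpace ℂ (Fin n)) :=
    (Set.univ.pi fun _ => Metric.sphere 0 1) ∩ {v | ‖overlapForm T v‖ = tensorSpectralNorm T}
  have hmem : ∀ v, v ∈ P ↔ (∀ j, ‖v j‖ = 1) ∧ ‖overlapForm T v‖ = tensorSpectralNorm T := by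
    intro v; simp [P]
  have hcont : Continuous fun v => ‖overlapForm T v‖ := by
    simp only [overlapForm_apply]; unfold pureTensor; fun_prop
  have hP : IsCompact P := (isCompact_univ_pi fun _ => isCompact_sphere _ _).inter_right
    (isClosed_eq hcont continuous_const)
  have hPne : P.Nonempty := ⟨v₀, (hmem _).mpr ⟨hv₀, hv₀max⟩⟩
  -- Among the norm-maximising tuples, one is chosen to be most aligned with `e`; its entries will
  -- be shown to coincide.
  obtain ⟨v, hvP, hvmax⟩ := hP.exists_isMaxOn hPne
    (f := fun v => ∑ j, (inner ℂ e (v j)).re) (by fun_prop)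
  obtain ⟨hv, hvT⟩ := (hmem v).mp hvP
  -- Sign changes preserve maximality, so the chosen tuple has every `Re ⟨e, v j⟩ ≥ 0`.
  have hsign : ∀ (w : Fin m → EuclideanSpace ℂ (Fin n)) (c : Fin m → ℝ), (∀ j, |c j| = 1) →
      w ∈ P → (fun j => (c j : ℂ) • w j) ∈ P := fun w c hc hw => by
    obtain ⟨h1, h2⟩ := (hmem w).mp hw
    refine (hmem _).mpr ⟨fun j => by simp [norm_smul, h1 j, hc j], ?_⟩
    rw [MultilinearMap.map_smul_univ, norm_smul, norm_prod, h2]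
    simp [hc]
  have habs : ∀ w ∈ P, ∑ j, |(inner ℂ e (w j)).re| ≤ ∑ j, (inner ℂ e (v j)).re := by
    intro w hw
    let c : Fin m → ℝ := fun j => if 0 ≤ (inner ℂ e (w j)).re then 1 else -1
    have hc : ∀ j, |c j| = 1 := fun j => by simp only [c]; split_ifs <;> simp
    have := hvmax (hsign w c hc hw)
    refine le_trans (le_of_eq ?_) this
    refine Finset.sum_congr rfl fun j _ => ?_
    simp only [inner_smul_right, Complex.re_ofReal_mul, c]
    split_ifs with h
    · rw [abs_of_nonneg h, one_mul]
    · rw [abs_of_neg (not_le.mp h), neg_one_mul]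
  have hnonneg : ∀ j, 0 ≤ (inner ℂ e (v j)).re := by
    have h0 : ∑ j, (|(inner ℂ e (v j)).re| - (inner ℂ e (v j)).re) ≤ 0 := by
      rw [Finset.sum_sub_distrib]; linarith [habs v hvP]
    have h1 : ∀ j ∈ Finset.univ, 0 ≤ |(inner ℂ e (v j)).re| - (inner ℂ e (v j)).re :=
      fun j _ => sub_nonneg.mpr (le_abs_self _)
    intro j
    have h2 := (Finset.single_le_sum h1 (Finset.mem_univ j)).trans h0
    linarith [abs_nonneg (inner ℂ e (v j)).re]
  have hpos : 0 < ∑ j, (inner ℂ e (v j)).re := by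
    refine lt_of_lt_of_le ?_ (habs v₀ ((hmem _).mpr ⟨hv₀, hv₀max⟩))
    refine Finset.sum_pos' (fun j _ => abs_nonneg _) ⟨⟨0, hm⟩, Finset.mem_univ _, ?_⟩
    rw [← he, inner_self_eq_norm_sq_to_K, he, hv₀]
    simp
  obtain ⟨a, ha⟩ : ∃ a, 0 < (inner ℂ e (v a)).re := by
    by_contra! hcon
    exact absurd (Finset.sum_nonpos fun j _ => hcon j) (not_le.mpr hpos)
  have hall : ∀ b, v b = v a := by
    intro b
    by_cases hab : a = b
    · rw [hab]
    set w := v a + v b with hw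
    have hre : 0 < (inner ℂ e w).re := by
      rw [hw, inner_add_right, Complex.add_re]; linarith [hnonneg b]
    have hw0 : 0 < ‖w‖ := norm_pos_iff.mpr fun h => by simp [h] at hre
    let u : EuclideanSpace ℂ (Fin n) := ((‖w‖⁻¹ : ℝ) : ℂ) • w
    have hu : ‖u‖ = 1 := by simp [u, norm_smul, hw0.ne']
    let v' := Function.update (Function.update v a u) b u
    have hv'P : v' ∈ P := by
      refine (hmem _).mpr ⟨fun j => ?_, ?_⟩
      · by_cases hjb : j = b
        · subst hjb; simpa [v']
        by_cases hja : j = a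
        · subst hja; simpa [v', Function.update_of_ne hjb]
        · simpa [v', Function.update_of_ne hja, Function.update_of_ne hjb] using hv j
      · have h := norm_overlapForm_update_update hn hT hv hvT hab
        simp only [v', u]
        rw [MultilinearMap.map_update_smul, Function.update_comm hab,
          MultilinearMap.map_update_smul, Function.update_comm (Ne.symm hab), norm_smul, norm_smul,
          h, Complex.norm_real, norm_inv, norm_norm, ← hw]
        field_simp
    have hsum : ∑ j, (inner ℂ e (v' j)).re = ∑ j, (inner ℂ e (v j)).re +
        (2 * (inner ℂ e u).re - (inner ℂ e w).re) := by
      have hs : ∀ f : Fin m → EuclideanSpace ℂ (Fin n), ∑ j, (inner ℂ e (f j)).re =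
          (inner ℂ e (f a)).re + ((inner ℂ e (f b)).re +
            ∑ j ∈ (Finset.univ.erase a).erase b, (inner ℂ e (f j)).re) := fun f => by
        rw [Finset.add_sum_erase _ (fun j => (inner ℂ e (f j)).re)
          (Finset.mem_erase.mpr ⟨Ne.symm hab, Finset.mem_univ b⟩),
          Finset.add_sum_erase _ (fun j => (inner ℂ e (f j)).re) (Finset.mem_univ a)]
      have hr : ∑ j ∈ (Finset.univ.erase a).erase b, (inner ℂ e (v' j)).re =
          ∑ j ∈ (Finset.univ.erase a).erase b, (inner ℂ e (v j)).re := by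
        refine Finset.sum_congr rfl fun j hj => ?_
        simp only [Finset.mem_erase] at hj
        simp only [v', Function.update_of_ne hj.1, Function.update_of_ne hj.2.1]
      rw [hs v', hs v, hr, hw, inner_add_right, Complex.add_re]
      simp only [v', Function.update_self, Function.update_of_ne hab]
      ring
    have hle : ∑ j, (inner ℂ e (v' j)).re ≤ ∑ j, (inner ℂ e (v j)).re := hvmax hv'P
    have hue : (inner ℂ e u).re = ‖w‖⁻¹ * (inner ℂ e w).re := by
      simp only [u, inner_smul_right, Complex.re_ofReal_mul]
    -- The replacement changes the alignment by `(2/‖w‖ - 1) Re ⟨e, w⟩`, which cannot be positive.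
    -- The parallelogram law then forces `v a = v b`.
    have h2 : 2 ≤ ‖w‖ := by
      rw [hsum, hue] at hle
      have h3 : (2 * ‖w‖⁻¹ - 1) * (inner ℂ e w).re ≤ 0 := by linarith
      have h4 : 2 * ‖w‖⁻¹ - 1 ≤ 0 := by
        by_contra! hcon
        linarith [mul_pos hcon hre]
      have h5 : 2 / ‖w‖ ≤ 1 := by rw [div_eq_mul_inv]; linarith
      rwa [div_le_one hw0] at h5
    have hpar := parallelogram_law_with_norm ℂ (v a) (v b)
    rw [hv a, hv b, ← hw] at hpar
    have h6 : ‖v a - v b‖ = 0 := by nlinarith [norm_nonneg (v a - v b)]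
    exact (sub_eq_zero.mp (norm_eq_zero.mp h6)).symm
  refine ⟨v a, hv a, ?_⟩
  rw [← hvT, overlapForm_apply, funext hall]

/-! ### Existence of the minimum and the final bound -/

theorem continuous_tensorSpectralNorm {n m : ℕ} (hn : 1 ≤ n) :
    Continuous (tensorSpectralNorm : CTensor n m → ℝ) := by
  refine (LipschitzWith.of_le_add fun A B => ?_).continuous
  obtain ⟨v, hv, h⟩ := exists_norm_overlapForm_eq hn A
  rw [← h, overlapForm_apply, dist_eq_norm]
  calc ‖inner ℂ A (pureTensor v)‖
      = ‖inner ℂ B (pureTensor v) + inner ℂ (A - B) (pureTensor v)‖ := by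
        rw [inner_sub_left, add_sub_cancel]
    _ ≤ tensorSpectralNorm B + ‖A - B‖ * ‖pureTensor v‖ :=
        (norm_add_le _ _).trans
          (add_le_add (norm_overlapForm_le hn B hv) (norm_inner_le_norm _ _))
    _ = _ := by simp [norm_pureTensor, hv]

theorem isCompact_unitSymmetricTensors (n m : ℕ) : IsCompact (unitSymmetricTensors n m) := by
  have : unitSymmetricTensors n m = Metric.sphere (0 : CTensor n m) 1 ∩
      ⋂ σ : Equiv.Perm (Fin m), {T | permuteFactors σ T = T} := by
    ext T
    simp [unitSymmetricTensors, and_comm]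
  rw [this]
  refine (isCompact_sphere _ _).inter_right (isClosed_iInter fun σ => isClosed_eq ?_ continuous_id)
  unfold permuteFactors
  fun_prop

theorem isLeast_minSymmetricSpectralNorm {n : ℕ} (m : ℕ) (hn : 1 ≤ n)
    (hne : (unitSymmetricTensors n m).Nonempty) :
    IsLeast (tensorSpectralNorm '' unitSymmetricTensors n m) (minSymmetricSpectralNorm n m) :=
  ((isCompact_unitSymmetricTensors n m).image (continuous_tensorSpectralNorm hn)).isLeast_sInf
    (hne.image _)

theorem minSymmetricSpectralNorm_pow_le {n m : ℕ} (hn : 1 ≤ n) (hm : 1 ≤ m) (K : ℕ) :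
    minSymmetricSpectralNorm n m ^ (2 * K) ≤
      (K.factorial : ℝ) * ((n + K * m - 1).choose (K * m) : ℝ) /
        ((n + m - 1).choose m : ℝ) ^ K := by
  obtain ⟨T, hT, hTle⟩ := exists_unitSymmetricTensor_moment_le hn m K
  have hleast := isLeast_minSymmetricSpectralNorm m hn ⟨T, hT⟩
  obtain ⟨u, hu, huT⟩ := exists_norm_inner_power_eq hn hm hT.1
  have h0 : 0 ≤ minSymmetricSpectralNorm n m := by
    obtain ⟨A, hA, h⟩ := hleast.1
    obtain ⟨v, -, hv⟩ := exists_norm_overlapForm_eq hn A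
    rw [← h, ← hv]
    exact norm_nonneg _
  calc _ ≤ tensorSpectralNorm T ^ (2 * K) :=
        pow_le_pow_left₀ h0 (hleast.2 ⟨T, hT, rfl⟩) _
    _ ≤ _ := huT ▸ hTle u hu

theorem minSymmetricSpectralNorm_sq_le {n m : ℕ} (hn : 2 ≤ n) (hm : 1 ≤ m) :
    minSymmetricSpectralNorm n m ^ 2 ≤
      ((n : ℝ) - 1) / (((m + n - 1).choose m : ℝ) - 1) *
        (1 / 2 + 5 / 2 * Real.log 2 + 3 / 2 * Real.log m) := by
  obtain ⟨r, rfl⟩ := Nat.exists_eq_add_of_le' (by omega : 1 ≤ n)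
  have hr : 1 ≤ r := by omega
  obtain ⟨k, hk, hL⟩ := exists_moment_bound m hm
  set L := 1 / 2 + 5 / 2 * Real.log 2 + 3 / 2 * Real.log m with hLdef
  have hL0 : 0 ≤ L := by
    have := Real.log_natCast_nonneg m
    have := Real.log_two_gt_d9
    positivity
  have hr0 : (0 : ℝ) < r := by exact_mod_cast hr
  have hd1 : (1 : ℝ) + r * m ≤ ((m + r).choose m : ℝ) := by
    exact_mod_cast one_add_mul_le_choose r m
  have hm0 : (1 : ℝ) ≤ m := by exact_mod_cast hm
  have hrm : (0 : ℝ) < r * m := by positivity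
  -- With `K = rk`, the moment bound becomes an `rk`-th power and the root can be taken exactly.
  have hmain := minSymmetricSpectralNorm_pow_le (n := r + 1) (by omega) hm (r * k)
  have e1 : r + 1 + r * k * m - 1 = r * k * m + r := by omega
  have e2 : r + 1 + m - 1 = m + r := by omega
  have e3 : m + (r + 1) - 1 = m + r := by omega
  have e4 : (r * k * m + r).choose (r * k * m) = (r * k * m + r).choose r :=
    Nat.choose_symm_add
  rw [e1, e2, e4] at hmain
  rw [e3]
  set d : ℝ := ((m + r).choose m : ℝ) with hd
  have hd0 : 0 < d := by linarith
  have hfinal : (minSymmetricSpectralNorm (r + 1) m ^ 2) ^ (r * k) ≤ (r * L / d) ^ (r * k) := by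
    rw [← pow_mul, div_pow, mul_pow]
    refine hmain.trans (div_le_div_of_nonneg_right ?_ (by positivity))
    refine (factorial_mul_choose_le r k m hk).trans ?_
    rw [mul_comm r k, pow_mul L]
    gcongr
  have hle := le_of_pow_le_pow_left₀ (by positivity) (by positivity) hfinal
  refine hle.trans ?_
  push_cast
  rw [add_sub_cancel_right, div_mul_eq_mul_div]
  -- The denominator `d` is weakened to `d - 1`.
  exact div_le_div_of_nonneg_left (by positivity) (by linarith) (by linarith)

theorem theorem1p8 (n m : ℕ) (hn : 2 ≤ n) (hm : 1 ≤ m) :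
    IsLeast (tensorSpectralNorm '' unitSymmetricTensors n m) (minSymmetricSpectralNorm n m) ∧
    ∀ ε : ℝ, 0 < ε → ε < 1 →
      minSymmetricSpectralNorm n m ^ 2 ≤
        (m : ℝ) ^ 2 * ε ^ 2 +
          ((n : ℝ) - 1) * Real.log (4 / ε) / (((m + n - 1).choose m : ℝ) - 1) := by
  have hn1 : 1 ≤ n := by omega
  -- The moment `K = 0` is used only to show that unit symmetric tensors exist.
  obtain ⟨T, hT, -⟩ := exists_unitSymmetricTensor_moment_le hn1 m 0
  refine ⟨isLeast_minSymmetricSpectralNorm m hn1 ⟨T, hT⟩, fun ε hε _ => ?_⟩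
  have hm0 : (1 : ℝ) ≤ m := by exact_mod_cast hm
  have hn0 : (0 : ℝ) < (n : ℝ) - 1 := by
    have : (2 : ℝ) ≤ n := by exact_mod_cast hn
    linarith
  have hd : ((n : ℝ) - 1) * m ≤ ((m + n - 1).choose m : ℝ) - 1 := by
    obtain ⟨r, rfl⟩ := Nat.exists_eq_add_of_le' hn1
    have h : (1 : ℝ) + r * m ≤ ((m + r).choose m : ℝ) := by
      exact_mod_cast one_add_mul_le_choose r m
    rw [show m + (r + 1) - 1 = m + r by omega]
    push_cast
    linarith
  have hd0 : 0 < ((m + n - 1).choose m : ℝ) - 1 := lt_of_lt_of_le (by positivity) hd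
  refine (minSymmetricSpectralNorm_sq_le hn hm).trans ?_
  rw [mul_div_right_comm]
  refine mul_log_le_of_pos (by positivity) (by linarith) ?_ hε
  rw [div_mul_eq_mul_div]
  exact (div_le_one hd0).mpr hd
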